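/- There are universal constants $c,C>0$ such that the following holds for every dimension $d$ and all reals $L,G,\varepsilon>0$ and $\delta\in(0,1)$. Let $g:\mathbb{R}^d\to\mathbb{R}$ be $L$-weakly convex, i.e. at every $x$ there is a vector $v$ (a subgradient, $v\in\partial g(x)$) with $g(x')\ge g(x)+\langle v,x'-x\rangle-\frac L2\|x'-x\|^2$ for all $x'$. Let a $G$-bounded stochastic subgradient oracle for $g$ be given: each query at a point $x'$ is answered by a fresh random vector $u$, whose law is a Markov kernel evaluated at $x'$, with $\|u\|\le G$ almost surely and $\mathbb{E}[u]\in\partial g(x')$. Let $x\in\mathbb{R}^d$ and let $g_{1/(2L)}(x)=\inf_{x'}\{g(x')+L\|x-x'\|^2\}$ be the Moreau envelope with parameter $\lambda=1/(2L)$. Consider the following algorithm, with $T=\lceil c\,G^2\log(2/\delta)/\varepsilon^2\rceil$. Start at any $x_1$ in the ball $B=\{x':\|x'-x\|\le G/(2L)\}$. For $t=1,\dots,T$ query the oracle at $x_t$, obtaining $u_t$, and set $$x_{t+1}=\Pi_B\Big(x_t-\tfrac{2}{L(t+1)}\big(u_t+2L(x_t-x)\big)\Big),$$ where $\Pi_B$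 is the Euclidean projection onto $B$. Put $\tilde x=\sum_{t=1}^T\frac{2t}{T(T+1)}x_t$ and return $u=2L(x-\tilde x)$. Then $g_{1/(2L)}$ is differentiable at $x$, and: 1. with probability at least $1-\delta$, $\;g(\tilde x)+L\|x-\tilde x\|^2\le\inf_{x'}\{g(x')+L\|x-x'\|^2\}+\frac{\varepsilon^2}{4L}$; 2. with probability at least $1-\delta$, the returned vector satisfies $\|u-\nabla g_{1/(2L)}(x)\|\le\varepsilon$; 3. the algorithm makes at most $\lceil c\,G^2\log(2/\delta)/\varepsilon^2\rceil$ oracle queries; in particular, if $\delta\le 1/2$ and $\varepsilon\le G$, it makes at most $C\,G^2\log(1/\delta)/\varepsilon^2$ queries. -/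

import Mathlib

open MeasureTheory ProbabilityTheory

noncomputable section

/-- `u` is a subgradient at `x` of the `L`-weakly convex function `g`. -/
def IsWeakSubgradient {d : ℕ} (L : ℝ) (g : EuclideanSpace ℝ (Fin d) → ℝ)
    (x u : EuclideanSpace ℝ (Fin d)) : Prop :=
  ∀ x', g x + inner ℝ u (x' - x) - L / 2 * ‖x' - x‖ ^ 2 ≤ g x'

/-- `L`-weak convexity: there is a subgradient at every point. -/
def IsWeaklyConvex {d : ℕ} (L : ℝ) (g : EuclideanSpace ℝ (Fin d) → ℝ) : Prop :=
  ∀ x, ∃ u, IsWeakSubgradient L g x u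

/-- The Moreau envelope of `g` with parameter `lam`. -/
def moreauEnvelope {d : ℕ} (g : EuclideanSpace ℝ (Fin d) → ℝ) (lam : ℝ)
    (x : EuclideanSpace ℝ (Fin d)) : ℝ :=
  ⨅ x', g x' + (2 * lam)⁻¹ * ‖x - x'‖ ^ 2

/-- A `G`-norm bounded stochastic subgradient oracle for `g`: queried at `x'`, it returns a fresh
random vector with law `κ x'`, whose norm is at most `G` and whose mean is a subgradient at `x'`. -/
def IsStochasticSubgradientOracle {d : ℕ} (L G : ℝ) (g : EuclideanSpace ℝ (Fin d) → ℝ)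
    (κ : Kernel (EuclideanSpace ℝ (Fin d)) (EuclideanSpace ℝ (Fin d))) : Prop :=
  ∀ x', (∀ᵐ u ∂(κ x'), ‖u‖ ≤ G) ∧ IsWeakSubgradient L g x' (∫ u, u ∂(κ x'))

/-- Adaptive programs that may query an oracle at points of `E`, receive answers in `E`, and
finally return an element of `α`. -/
inductive OracleProgram (E α : Type*) where
  | ret (a : α) : OracleProgram E α
  | query (x : E) (k : E → OracleProgram E α) : OracleProgram E α

namespace OracleProgram

/-- Apply a function to the returned value, without further queries. -/
def map {E α β : Type*} (f : α → β) : OracleProgram E α → OracleProgram E β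
  | ret a => ret (f a)
  | query x k => query x (fun u => (k u).map f)

/-- On all possible answers of the oracle, the program makes at most `n` queries. -/
def QueriesAtMost {E α : Type*} : OracleProgram E α → ℕ → Prop
  | ret _, _ => True
  | query _ _, 0 => False
  | query _ k, n + 1 => ∀ u, (k u).QueriesAtMost n

/-- The law of the value returned by the program when a query at `x` is answered by a fresh sample
of `κ x`, independent of the earlier answers given `x`. -/
def law {E α : Type*} [MeasurableSpace E] [MeasurableSpace α] (κ : Kernel E E) :
    OracleProgram E α → Measure α
  | ret a => Measure.dirac a
  | query x k => (κ x).bind (fun u => (k u).law κ)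

end OracleProgram

/-- Euclidean projection onto the closed ball with centre `x` and radius `r`. -/
def ballProj {d : ℕ} (x : EuclideanSpace ℝ (Fin d)) (r : ℝ) (y : EuclideanSpace ℝ (Fin d)) :
    EuclideanSpace ℝ (Fin d) :=
  if ‖y - x‖ ≤ r then y else x + (r / ‖y - x‖) • (y - x)

/-- The projection lands in the ball. -/
theorem ballProj_mem {d : ℕ} (x : EuclideanSpace ℝ (Fin d)) {r : ℝ} (hr : 0 ≤ r)
    (y : EuclideanSpace ℝ (Fin d)) : ballProj x r y ∈ Metric.closedBall x r := by
  rw [mem_closedBall_iff_norm, ballProj]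
  split_ifs with h
  · exact h
  · have hpos : 0 < ‖y - x‖ := lt_of_le_of_lt hr (not_le.mp h)
    rw [add_sub_cancel_left, norm_smul, Real.norm_eq_abs, abs_of_nonneg (by positivity),
      div_mul_cancel₀ _ hpos.ne']

/-- The projection is a nearest point of the ball. -/
theorem norm_sub_ballProj_le {d : ℕ} (x : EuclideanSpace ℝ (Fin d)) {r : ℝ} (hr : 0 ≤ r)
    (y z : EuclideanSpace ℝ (Fin d)) (hz : z ∈ Metric.closedBall x r) :
    ‖y - ballProj x r y‖ ≤ ‖y - z‖ := by
  rw [mem_closedBall_iff_norm] at hz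
  rw [ballProj]
  split_ifs with h
  · simp
  · have hlt : r < ‖y - x‖ := not_le.mp h
    have hpos : 0 < ‖y - x‖ := lt_of_le_of_lt hr hlt
    have e : y - (x + (r / ‖y - x‖) • (y - x)) = (1 - r / ‖y - x‖) • (y - x) := by
      rw [sub_smul, one_smul]; abel
    have h1 : 0 ≤ 1 - r / ‖y - x‖ := by
      rw [sub_nonneg, div_le_one hpos]; exact hlt.le
    rw [e, norm_smul, Real.norm_eq_abs, abs_of_nonneg h1, sub_mul, one_mul,
      div_mul_cancel₀ _ hpos.ne']
    have h2 : ‖y - x‖ ≤ ‖y - z‖ + ‖z - x‖ := norm_sub_le_norm_sub_add_norm_sub y z x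
    linarith

/-- Projected stochastic subgradient descent with `n` remaining iterations, numbered from `t` on,
current iterate `y` and accumulated weighted sum `acc` of iterates. Every iteration makes one oracle
query; `proj` is the projection, `s y u` the stochastic subgradient of the objective at `y` made
from the oracle's answer `u`, `η` the step sizes and `γ` the averaging weights. -/
def projectedSGD {d : ℕ} (proj : EuclideanSpace ℝ (Fin d) → EuclideanSpace ℝ (Fin d))
    (s : EuclideanSpace ℝ (Fin d) → EuclideanSpace ℝ (Fin d) → EuclideanSpace ℝ (Fin d))
    (η γ : ℕ → ℝ) : (n t : ℕ) → (y acc : EuclideanSpace ℝ (Fin d)) →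
      OracleProgram (EuclideanSpace ℝ (Fin d)) (EuclideanSpace ℝ (Fin d))
  | 0, _, _, acc => .ret acc
  | n + 1, t, y, acc =>
      .query y (fun u => projectedSGD proj s η γ n (t + 1) (proj (y - η t • s y u)) (acc + γ t • y))

/-- Number of iterations, `⌈c G² log (2/δ) / ε²⌉`. -/
def sgdIterations (c G ε δ : ℝ) : ℕ := ⌈c * G ^ 2 * Real.log (2 / δ) / ε ^ 2⌉₊

/-- `T` iterations of projected SGD, started at `x₁`, for the `L`-strongly convex objective
`x' ↦ g x' + L ‖x - x'‖²` on the ball of radius `G / (2L)` around `x`: the step sizes are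
`2 / (L (t + 1))` and the output is the average of the iterates `x₁, …, x_T` with weights
proportional to `t`. A stochastic subgradient `u` of `g` at `y` gives the stochastic subgradient
`u + 2L (y - x)` of the objective. -/
def proxSGD {d : ℕ} (L G : ℝ) (T : ℕ) (x x₁ : EuclideanSpace ℝ (Fin d)) :
    OracleProgram (EuclideanSpace ℝ (Fin d)) (EuclideanSpace ℝ (Fin d)) :=
  projectedSGD (ballProj x (G / (2 * L))) (fun y u => u + (2 * L) • (y - x))
    (fun t => 2 / (L * (t + 1))) (fun t => 2 * t / (T * (T + 1))) T 1 x₁ 0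

/-- Estimate of the gradient at `x` of the Moreau envelope with parameter `1 / (2L)`: solve the prox
subproblem approximately by SGD, and return `2L (x - x̃)` for the point `x̃` found. -/
def moreauGradientEstimate {d : ℕ} (c L G ε δ : ℝ) (x x₁ : EuclideanSpace ℝ (Fin d)) :
    OracleProgram (EuclideanSpace ℝ (Fin d)) (EuclideanSpace ℝ (Fin d)) :=
  (proxSGD L G (sgdIterations c G ε δ) x x₁).map (fun xt => (2 * L) • (x - xt))

end

/-! Write `F` for the prox objective and `p` for its minimizer. Since `F` is `L`-strongly convex, it
grows by at least `L/2 ‖z - p‖²` away from `p`. The gradient of the envelope at `x` is `2L (x - p)`,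
so a point with small objective gap gives a good gradient estimate; it remains to bound the gap of
the averaged iterate with high probability.

Multiplying the one-step descent inequality by `t (t + 1)` makes the distance terms telescope
(`sgd_step_le`). What remains is the noise `⟪y - p, u - 𝔼 u⟫`. By Hoeffding's lemma its exponential
moment costs a multiple of `‖y - p‖²`, and quadratic growth pays for this with half of the objective
gap gained in the same step. This self-bounding makes an exponential potential a supermartingale
without any union bound. `law_projectedSGD_tail_le` runs the argument as an induction on the number
of remaining iterations, with the potential as a bound on the failure probability from any state;
from the initial state it gives `exp (2 - L (T + 1) θ / (8 G²))` for a gap exceeding `θ`. -/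

/-! ### Strong convexity of the prox subproblem and its minimizer. -/

/-- The objective of the prox subproblem at `x`. -/
noncomputable def proxObjective {d : ℕ} (L : ℝ) (g : EuclideanSpace ℝ (Fin d) → ℝ)
    (x z : EuclideanSpace ℝ (Fin d)) : ℝ :=
  g z + L * ‖x - z‖ ^ 2

/-- A weak subgradient of `g` yields a strong subgradient of the prox objective. -/
theorem IsWeakSubgradient.proxObjective_le {d : ℕ} {L : ℝ} {g : EuclideanSpace ℝ (Fin d) → ℝ}
    {q v : EuclideanSpace ℝ (Fin d)} (h : IsWeakSubgradient L g q v)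
    (x z : EuclideanSpace ℝ (Fin d)) :
    proxObjective L g x q + inner ℝ (v + (2 * L) • (q - x)) (z - q) + L / 2 * ‖z - q‖ ^ 2 ≤
      proxObjective L g x z := by
  have e : ‖x - z‖ ^ 2 = ‖x - q‖ ^ 2 + 2 * inner ℝ (q - x) (z - q) + ‖z - q‖ ^ 2 := by
    rw [norm_sub_rev x z, norm_sub_rev x q, ← norm_add_sq_real]
    congr 2; abel
  have := h z
  simp only [proxObjective, e, inner_add_left, real_inner_smul_left]
  linarith

/-- Average the subgradient inequalities at the intermediate point, tested at `a` and `b`: the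
linear terms cancel. -/
theorem IsWeakSubgradient.convex_comb_le {d : ℕ} {L : ℝ} {g : EuclideanSpace ℝ (Fin d) → ℝ}
    {a b v : EuclideanSpace ℝ (Fin d)} {s : ℝ} (hs0 : 0 ≤ s) (hs1 : s ≤ 1)
    (h : IsWeakSubgradient L g (a + s • (b - a)) v) (x : EuclideanSpace ℝ (Fin d)) :
    proxObjective L g x (a + s • (b - a)) + L / 2 * (s * (1 - s)) * ‖b - a‖ ^ 2 ≤
      (1 - s) * proxObjective L g x a + s * proxObjective L g x b := by
  have h1 := h.proxObjective_le x a
  have h2 := h.proxObjective_le x b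
  have e1 : a - (a + s • (b - a)) = (-s) • (b - a) := by module
  have e2 : b - (a + s • (b - a)) = (1 - s) • (b - a) := by module
  rw [e1, norm_smul, real_inner_smul_right, Real.norm_eq_abs, mul_pow, sq_abs] at h1
  rw [e2, norm_smul, real_inner_smul_right, Real.norm_eq_abs, mul_pow, sq_abs] at h2
  have h1' := mul_le_mul_of_nonneg_left h1 (sub_nonneg.mpr hs1)
  have h2' := mul_le_mul_of_nonneg_left h2 hs0
  linarith

/-- Adding `L ‖z‖²` makes `g` convex, and a finite convex function on a finite-dimensional space is
locally Lipschitz. -/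
theorem IsWeaklyConvex.continuous {d : ℕ} {L : ℝ} (hL : 0 ≤ L)
    {g : EuclideanSpace ℝ (Fin d) → ℝ} (hg : IsWeaklyConvex L g) : Continuous g := by
  have hc : ConvexOn ℝ Set.univ (proxObjective L g 0) := by
    refine ⟨convex_univ, fun a _ b _ r s hr hs hrs => ?_⟩
    obtain ⟨v, hv⟩ := hg (a + s • (b - a))
    have h := hv.convex_comb_le hs (by linarith) 0
    obtain rfl : r = 1 - s := by linarith
    have e : (1 - s) • a + s • b = a + s • (b - a) := by module
    rw [e, smul_eq_mul, smul_eq_mul]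
    have : 0 ≤ L / 2 * (s * (1 - s)) * ‖b - a‖ ^ 2 := by positivity
    linarith
  have h1 : Continuous (proxObjective L g 0) := hc.locallyLipschitz.continuous
  have h2 : g = fun z => proxObjective L g 0 z - L * ‖0 - z‖ ^ 2 := by
    funext z; simp [proxObjective]
  rw [h2]
  fun_prop

theorem continuous_proxObjective {d : ℕ} {L : ℝ} (hL : 0 ≤ L)
    {g : EuclideanSpace ℝ (Fin d) → ℝ} (hg : IsWeaklyConvex L g)
    (x : EuclideanSpace ℝ (Fin d)) : Continuous (proxObjective L g x) := by
  have := hg.continuous hL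
  unfold proxObjective
  fun_prop

/-- A real number bounded below by `(1 - s) * k` for all `s ∈ (0, 1)` is at least `k`. -/
theorem le_of_forall_one_sub_mul_le {k m : ℝ} (h : ∀ s : ℝ, 0 < s → s < 1 → (1 - s) * k ≤ m) :
    k ≤ m := by
  have ht : Filter.Tendsto (fun s : ℝ => (1 - s) * k) (nhdsWithin 0 (Set.Ioi 0)) (nhds k) := by
    have : Filter.Tendsto (fun s : ℝ => (1 - s) * k) (nhds 0) (nhds ((1 - 0) * k)) :=
      Continuous.tendsto (by fun_prop) 0
    simpa using this.mono_left nhdsWithin_le_nhds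
  refine le_of_tendsto ht ?_
  filter_upwards [Ioo_mem_nhdsGT (zero_lt_one' ℝ)] with s hs using h s hs.1 hs.2

/-- Quadratic growth of the prox objective away from its minimizer. -/
theorem IsWeaklyConvex.quadratic_growth {d : ℕ} {L : ℝ} {g : EuclideanSpace ℝ (Fin d) → ℝ}
    (hg : IsWeaklyConvex L g) {x p : EuclideanSpace ℝ (Fin d)}
    (hp : ∀ z, proxObjective L g x p ≤ proxObjective L g x z) (z : EuclideanSpace ℝ (Fin d)) :
    proxObjective L g x p + L / 2 * ‖z - p‖ ^ 2 ≤ proxObjective L g x z := by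
  rw [← le_sub_iff_add_le']
  refine le_of_forall_one_sub_mul_le fun s hs0 hs1 => ?_
  obtain ⟨v, hv⟩ := hg (p + s • (z - p))
  have h := hv.convex_comb_le hs0.le hs1.le x
  have h' := hp (p + s • (z - p))
  refine le_of_mul_le_mul_left ?_ hs0
  linarith

/-- Beyond radius `2 ‖v‖ / L` the quadratic term outweighs the slope `v` at `x`, so values there are
at least the value at `x` and compactness of the ball suffices. -/
theorem IsWeaklyConvex.exists_prox {d : ℕ} {L : ℝ} (hL : 0 < L)
    {g : EuclideanSpace ℝ (Fin d) → ℝ} (hg : IsWeaklyConvex L g)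
    (x : EuclideanSpace ℝ (Fin d)) :
    ∃ p, ∀ z, proxObjective L g x p ≤ proxObjective L g x z := by
  obtain ⟨v, hv⟩ := hg x
  have hr : 0 ≤ 2 * ‖v‖ / L := by positivity
  obtain ⟨p, -, hp⟩ := (isCompact_closedBall x (2 * ‖v‖ / L)).exists_isMinOn
    ⟨x, Metric.mem_closedBall_self hr⟩ (continuous_proxObjective hL.le hg x).continuousOn
  refine ⟨p, fun z => ?_⟩
  by_cases hz : z ∈ Metric.closedBall x (2 * ‖v‖ / L)
  · exact hp hz
  · refine (hp (Metric.mem_closedBall_self hr)).trans ?_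
    have h := hv.proxObjective_le x z
    rw [mem_closedBall_iff_norm, not_le, div_lt_iff₀ hL] at hz
    simp only [sub_self, smul_zero, add_zero] at h
    have h2 := neg_le_of_abs_le (abs_real_inner_le_norm v (z - x))
    nlinarith [norm_nonneg (z - x)]

/-- If `g` has a subgradient of norm at most `G` at every point, the prox point is at distance at
most `G / (2L)`. -/
theorem norm_prox_sub_le {d : ℕ} {L G : ℝ} (hL : 0 < L) (hG : 0 ≤ G)
    {g : EuclideanSpace ℝ (Fin d) → ℝ}
    (hg : ∀ z, ∃ v, ‖v‖ ≤ G ∧ IsWeakSubgradient L g z v) {x p : EuclideanSpace ℝ (Fin d)}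
    (hp : ∀ z, proxObjective L g x p ≤ proxObjective L g x z) :
    ‖p - x‖ ≤ G / (2 * L) := by
  rcases (norm_nonneg (p - x)).eq_or_lt with h0 | h0
  · rw [← h0]; positivity
  rw [le_div_iff₀ (by positivity), mul_comm]
  refine le_of_forall_one_sub_mul_le fun s hs0 hs1 => ?_
  -- The subgradient certifying optimality of `p` need not be the one bounded by `G`, so bounded
  -- subgradients are taken at points approaching `p` from `x`.
  obtain ⟨v, hvG, hv⟩ := hg (p + s • (x - p))
  have h1 := hv p
  have h2 := hp (p + s • (x - p))
  have e1 : p - (p + s • (x - p)) = s • (p - x) := by module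
  have e2 : x - (p + s • (x - p)) = (1 - s) • (x - p) := by module
  rw [e1, norm_smul, real_inner_smul_right, Real.norm_eq_abs, mul_pow, sq_abs] at h1
  rw [proxObjective, proxObjective, e2, norm_smul, Real.norm_eq_abs, mul_pow, sq_abs,
    norm_sub_rev x p] at h2
  have h3 := neg_le_of_abs_le (abs_real_inner_le_norm v (p - x))
  have h4 : s * (‖v‖ * ‖p - x‖) ≤ s * (G * ‖p - x‖) := by gcongr
  have h5 := mul_le_mul_of_nonneg_left h3 hs0.le
  have h6 : (s * ‖p - x‖) * ((1 - s) * (2 * L * ‖p - x‖)) ≤ (s * ‖p - x‖) * G := by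
    nlinarith [mul_nonneg hL.le (mul_nonneg (sq_nonneg s) (sq_nonneg ‖p - x‖))]
  exact le_of_mul_le_mul_left h6 (by positivity)

/-! ### The Moreau envelope and its gradient. -/

theorem iInf_proxObjective {d : ℕ} {L : ℝ} {g : EuclideanSpace ℝ (Fin d) → ℝ}
    {x p : EuclideanSpace ℝ (Fin d)}
    (hp : ∀ z, proxObjective L g x p ≤ proxObjective L g x z) :
    ⨅ z, g z + L * ‖x - z‖ ^ 2 = proxObjective L g x p :=
  le_antisymm (ciInf_le ⟨proxObjective L g x p, Set.forall_mem_range.mpr hp⟩ p) (le_ciInf hp)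

theorem moreauEnvelope_one_div {d : ℕ} (L : ℝ) (g : EuclideanSpace ℝ (Fin d) → ℝ)
    (x : EuclideanSpace ℝ (Fin d)) :
    moreauEnvelope g (1 / (2 * L)) x = ⨅ z, g z + L * ‖x - z‖ ^ 2 := by
  have : (2 * (1 / (2 * L)))⁻¹ = L := by
    rw [one_div, mul_inv, inv_inv]; ring
  simp only [moreauEnvelope, this]

/-- The Moreau envelope is differentiable with gradient `2L (x - prox x)`. -/
theorem IsWeaklyConvex.hasGradientAt_moreauEnvelope {d : ℕ} {L : ℝ} (hL : 0 < L)
    {g : EuclideanSpace ℝ (Fin d) → ℝ} (hg : IsWeaklyConvex L g)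
    {x p : EuclideanSpace ℝ (Fin d)}
    (hp : ∀ z, proxObjective L g x p ≤ proxObjective L g x z) :
    HasGradientAt (moreauEnvelope g (1 / (2 * L))) ((2 * L) • (x - p)) x := by
  rw [hasGradientAt_iff_isLittleO]
  have key : ∀ y, |moreauEnvelope g (1 / (2 * L)) y - moreauEnvelope g (1 / (2 * L)) x
      - inner ℝ ((2 * L) • (x - p)) (y - x)| ≤ L * ‖y - x‖ ^ 2 := by
    intro y
    obtain ⟨q, hq⟩ := hg.exists_prox hL y
    rw [moreauEnvelope_one_div, moreauEnvelope_one_div, iInf_proxObjective hp,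
      iInf_proxObjective hq, real_inner_smul_left]
    have e : ∀ z, ‖y - z‖ ^ 2 =
        ‖x - z‖ ^ 2 + 2 * inner ℝ (x - z) (y - x) + ‖y - x‖ ^ 2 := fun z => by
      rw [← norm_add_sq_real]; congr 2; abel
    -- The upper bound uses `p` as competitor in the problem at `y`. In the lower bound, quadratic
    -- growth at `q` absorbs the cross term `2L ⟪q - p, y - x⟫` by completing the square `h4`.
    have h1 := hq p
    have h2 := hg.quadratic_growth hp q
    have e1 : inner ℝ (x - q) (y - x) = inner ℝ (x - p) (y - x) - inner ℝ (q - p) (y - x) := by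
      rw [← inner_sub_left]; congr 1; abel
    have h3 := le_of_abs_le (abs_real_inner_le_norm (q - p) (y - x))
    have h4 : 0 ≤ L * (‖q - p‖ - 2 * ‖y - x‖) ^ 2 := by positivity
    have h5 := mul_le_mul_of_nonneg_left h3 hL.le
    simp only [proxObjective] at h1 h2 ⊢
    rw [e q, e p, e1] at h1
    rw [e q, e1]
    rw [abs_le]
    constructor <;> nlinarith
  refine Asymptotics.IsBigO.trans_isLittleO (g := fun y => ‖y - x‖ ^ 2) ?_ ?_
  · refine Asymptotics.IsBigO.of_bound L (Filter.Eventually.of_forall fun y => ?_)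
    simpa using key y
  · exact Asymptotics.isLittleO_pow_sub_sub x one_lt_two

/-! ### Projection onto the ball and Hoeffding's lemma. -/

theorem norm_ballProj_sub_le {d : ℕ} (x : EuclideanSpace ℝ (Fin d)) {r : ℝ} (hr : 0 ≤ r)
    {p : EuclideanSpace ℝ (Fin d)} (hp : p ∈ Metric.closedBall x r)
    (y : EuclideanSpace ℝ (Fin d)) : ‖ballProj x r y - p‖ ≤ ‖y - p‖ := by
  rw [mem_closedBall_iff_norm] at hp
  rw [ballProj]
  split_ifs with h
  · exact le_rfl
  rw [not_le] at h
  have hpos : 0 < ‖y - x‖ := hr.trans_lt h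
  have e1 : x + (r / ‖y - x‖) • (y - x) - p = (r / ‖y - x‖) • (y - x) - (p - x) := by abel
  have e2 : y - p = (y - x) - (p - x) := by abel
  rw [e1, e2]
  refine (pow_le_pow_iff_left₀ (norm_nonneg _) (norm_nonneg _) two_ne_zero).mp ?_
  have hα0 : 0 ≤ r / ‖y - x‖ := by positivity
  have hα1 : r / ‖y - x‖ ≤ 1 := (div_le_one hpos).mpr h.le
  have hr' : r = r / ‖y - x‖ * ‖y - x‖ := by field_simp
  rw [norm_sub_sq_real (_ • _), norm_sub_sq_real (y - x), norm_smul, real_inner_smul_left,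
    Real.norm_eq_abs, mul_pow, sq_abs]
  generalize r / ‖y - x‖ = α at *
  have h1 : inner ℝ (y - x) (p - x) ≤ ‖y - x‖ * (α * ‖y - x‖) := by
    refine (real_inner_le_norm _ _).trans ?_
    gcongr
    linarith
  have h2 := mul_le_mul_of_nonneg_left h1 (sub_nonneg.mpr hα1)
  nlinarith [mul_nonneg (sq_nonneg (1 - α)) (sq_nonneg ‖y - x‖)]

theorem measurable_ballProj {d : ℕ} (x : EuclideanSpace ℝ (Fin d)) (r : ℝ) :
    Measurable (ballProj x r) := by
  unfold ballProj
  exact Measurable.ite (measurableSet_le (by fun_prop) (by fun_prop)) (by fun_prop) (by fun_prop)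

/-- Hoeffding's lemma for the scalar products of a bounded random vector with a fixed vector. -/
theorem lintegral_exp_inner_le {d : ℕ} {G : ℝ} (hG : 0 ≤ G)
    {μ : Measure (EuclideanSpace ℝ (Fin d))} [IsProbabilityMeasure μ] (h : ∀ᵐ u ∂μ, ‖u‖ ≤ G)
    (w : EuclideanSpace ℝ (Fin d)) (t : ℝ) :
    ∫⁻ u, ENNReal.ofReal (Real.exp (t * (inner ℝ w u - inner ℝ w (∫ u, u ∂μ)))) ∂μ ≤
      ENNReal.ofReal (Real.exp ((G * ‖w‖) ^ 2 * t ^ 2 / 2)) := by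
  have hint : Integrable (fun u : EuclideanSpace ℝ (Fin d) => u) μ :=
    Integrable.of_bound (by fun_prop) G h
  have hb : ∀ᵐ u ∂μ, inner ℝ w u ∈ Set.Icc (-(G * ‖w‖)) (G * ‖w‖) := by
    filter_upwards [h] with u hu
    rw [Set.mem_Icc, ← abs_le, mul_comm]
    exact (abs_real_inner_le_norm w u).trans (by gcongr)
  have hs := hasSubgaussianMGF_of_mem_Icc (X := fun u => inner ℝ w u) (μ := μ) (by fun_prop) hb
  have hm := hs.mgf_le t
  have hi := hs.integrable_exp_mul t
  simp only [mgf, integral_inner hint] at hm hi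
  rw [← ofReal_integral_eq_lintegral_ofReal hi
    (Filter.Eventually.of_forall fun _ => (Real.exp_pos _).le)]
  refine ENNReal.ofReal_le_ofReal (hm.trans_eq ?_)
  congr 3
  have : 0 ≤ G * ‖w‖ := by positivity
  simp only [NNReal.coe_pow, NNReal.coe_div, coe_nnnorm, NNReal.coe_ofNat, Real.norm_eq_abs,
    sub_neg_eq_add, ← two_mul, abs_mul, abs_two, abs_of_nonneg this]
  rw [mul_div_cancel_left₀ _ two_ne_zero]

/-! ### Measurability and laws of the SGD program. -/

section Law

variable {d : ℕ} {proj : EuclideanSpace ℝ (Fin d) → EuclideanSpace ℝ (Fin d)}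
  {s : EuclideanSpace ℝ (Fin d) → EuclideanSpace ℝ (Fin d) → EuclideanSpace ℝ (Fin d)}

/-- Needed to evaluate `Measure.bind` on sets. Measurability is joint in iterate and accumulator
because each query changes both. -/
theorem measurable_law_projectedSGD (hproj : Measurable proj)
    (hs : Measurable (Function.uncurry s)) (η γ : ℕ → ℝ)
    (κ : Kernel (EuclideanSpace ℝ (Fin d)) (EuclideanSpace ℝ (Fin d))) [IsMarkovKernel κ]
    (n : ℕ) : ∀ t : ℕ, Measurable
      (fun q : EuclideanSpace ℝ (Fin d) × EuclideanSpace ℝ (Fin d) =>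
        (projectedSGD proj s η γ n t q.1 q.2).law κ) := by
  induction n with
  | zero => exact fun t => Measure.measurable_dirac.comp measurable_snd
  | succ n ih =>
    intro t
    have hφ : Measurable (fun r : (EuclideanSpace ℝ (Fin d) × EuclideanSpace ℝ (Fin d)) ×
        EuclideanSpace ℝ (Fin d) =>
          (proj (r.1.1 - η t • s r.1.1 r.2), r.1.2 + γ t • r.1.1)) := by
      have h1 : Measurable (fun r : (EuclideanSpace ℝ (Fin d) × EuclideanSpace ℝ (Fin d)) ×
        EuclideanSpace ℝ (Fin d) => s r.1.1 r.2) :=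
        hs.comp (f := fun r : (EuclideanSpace ℝ (Fin d) × EuclideanSpace ℝ (Fin d)) ×
          EuclideanSpace ℝ (Fin d) => (r.1.1, r.2)) (by fun_prop)
      fun_prop
    have hK := (ih (t + 1)).comp hφ
    refine Measure.measurable_of_measurable_coe _ fun A hA => ?_
    have e : ∀ q : EuclideanSpace ℝ (Fin d) × EuclideanSpace ℝ (Fin d),
        (projectedSGD proj s η γ (n + 1) t q.1 q.2).law κ A =
          ∫⁻ u, (projectedSGD proj s η γ n (t + 1) (proj (q.1 - η t • s q.1 u))
            (q.2 + γ t • q.1)).law κ A ∂(κ q.1) := fun q =>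
      Measure.bind_apply hA
        (hK.comp (measurable_const.prodMk measurable_id : Measurable (fun u => (q, u)))).aemeasurable
    simp only [e]
    exact Measurable.lintegral_kernel_prod_right' (κ := κ.comap Prod.fst measurable_fst)
      ((Measure.measurable_coe hA).comp hK)

theorem measurable_law_projectedSGD_answer (hproj : Measurable proj)
    (hs : Measurable (Function.uncurry s)) (η γ : ℕ → ℝ)
    (κ : Kernel (EuclideanSpace ℝ (Fin d)) (EuclideanSpace ℝ (Fin d))) [IsMarkovKernel κ]
    (n t : ℕ) (y acc : EuclideanSpace ℝ (Fin d)) (a : ℝ) :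
    Measurable (fun u => (projectedSGD proj s η γ n t (proj (y - a • s y u)) acc).law κ) := by
  have h1 : Measurable (fun u => s y u) :=
    hs.comp (measurable_const.prodMk measurable_id : Measurable (fun u => (y, u)))
  exact (measurable_law_projectedSGD hproj hs η γ κ n t).comp
    (by fun_prop : Measurable fun u => (proj (y - a • s y u), acc))

theorem isProbabilityMeasure_law_projectedSGD (hproj : Measurable proj)
    (hs : Measurable (Function.uncurry s)) (η γ : ℕ → ℝ)
    (κ : Kernel (EuclideanSpace ℝ (Fin d)) (EuclideanSpace ℝ (Fin d))) [IsMarkovKernel κ]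
    (n : ℕ) : ∀ (t : ℕ) (y acc : EuclideanSpace ℝ (Fin d)),
      IsProbabilityMeasure ((projectedSGD proj s η γ n t y acc).law κ) := by
  induction n with
  | zero => exact fun t y acc => Measure.dirac.isProbabilityMeasure
  | succ n ih =>
    refine fun t y acc => ⟨?_⟩
    refine (Measure.bind_apply MeasurableSet.univ
      (measurable_law_projectedSGD_answer hproj hs η γ κ n (t + 1) y _ _).aemeasurable).trans ?_
    have := fun u => (ih (t + 1) (proj (y - η t • s y u)) (acc + γ t • y)).measure_univ
    simp [this]

theorem law_map_projectedSGD (hproj : Measurable proj)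
    (hs : Measurable (Function.uncurry s)) (η γ : ℕ → ℝ)
    (κ : Kernel (EuclideanSpace ℝ (Fin d)) (EuclideanSpace ℝ (Fin d))) [IsMarkovKernel κ]
    {f : EuclideanSpace ℝ (Fin d) → EuclideanSpace ℝ (Fin d)} (hf : Measurable f) (n : ℕ) :
    ∀ (t : ℕ) (y acc : EuclideanSpace ℝ (Fin d)),
      ((projectedSGD proj s η γ n t y acc).map f).law κ =
        ((projectedSGD proj s η γ n t y acc).law κ).map f := by
  induction n with
  | zero => exact fun t y acc => (Measure.map_dirac' hf acc).symm
  | succ n ih =>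
    intro t y acc
    have hm := measurable_law_projectedSGD_answer hproj hs η γ κ n (t + 1) y (acc + γ t • y) (η t)
    simp only [projectedSGD, OracleProgram.map, OracleProgram.law, ih]
    ext A hA
    have hm' : Measurable fun u => ((projectedSGD proj s η γ n (t + 1) (proj (y - η t • s y u))
        (acc + γ t • y)).law κ).map f := (Measure.measurable_map f hf).comp hm
    rw [Measure.map_apply hf hA, Measure.bind_apply (hf hA) hm.aemeasurable,
      Measure.bind_apply hA hm'.aemeasurable]
    simp_rw [Measure.map_apply hf hA]

theorem queriesAtMost_map_projectedSGD (η γ : ℕ → ℝ)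
    (f : EuclideanSpace ℝ (Fin d) → EuclideanSpace ℝ (Fin d)) (n : ℕ) :
    ∀ (t : ℕ) (y acc : EuclideanSpace ℝ (Fin d)),
      ((projectedSGD proj s η γ n t y acc).map f).QueriesAtMost n := by
  induction n with
  | zero => exact fun t y acc => trivial
  | succ n ih => exact fun t y acc u => ih (t + 1) _ _

end Law

/-! ### Descent inequality and tail bound for SGD. -/

/-- One step of projected subgradient descent, with the weights of the telescoping sum. -/
theorem sgd_step_le {d : ℕ} {L G : ℝ} (hL : 0 < L) (hG : 0 < G)
    {g : EuclideanSpace ℝ (Fin d) → ℝ} {x p y u v : EuclideanSpace ℝ (Fin d)}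
    (hp : p ∈ Metric.closedBall x (G / (2 * L))) (hy : y ∈ Metric.closedBall x (G / (2 * L)))
    (hu : ‖u‖ ≤ G) (hv : IsWeakSubgradient L g y v) {t : ℝ} (ht : 0 ≤ t) :
    (t + 1) * t * ‖ballProj x (G / (2 * L))
        (y - (2 / (L * (t + 1))) • (u + (2 * L) • (y - x))) - p‖ ^ 2 ≤
      t * (t - 1) * ‖y - p‖ ^ 2 - 4 * t / L * (proxObjective L g x y - proxObjective L g x p)
        - 4 * t / L * (inner ℝ (y - p) u - inner ℝ (y - p) v) + 16 * G ^ 2 / L ^ 2 := by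
  have hsub := hv.proxObjective_le x p
  set sv := u + (2 * L) • (y - x) with hsv
  have hs : ‖sv‖ ≤ 2 * G := by
    refine (norm_add_le _ _).trans ?_
    rw [mem_closedBall_iff_norm, le_div_iff₀ (by positivity)] at hy
    rw [norm_smul, Real.norm_eq_abs, abs_of_pos (by positivity)]
    linarith
  have hproj := norm_ballProj_sub_le x (by positivity : 0 ≤ G / (2 * L)) hp
    (y - (2 / (L * (t + 1))) • sv)
  have hproj2 := pow_le_pow_left₀ (norm_nonneg _) hproj 2
  have e1 : y - (2 / (L * (t + 1))) • sv - p = (y - p) - (2 / (L * (t + 1))) • sv := by abel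
  rw [e1, norm_sub_sq_real (y - p), real_inner_smul_right, norm_smul, Real.norm_eq_abs, mul_pow, sq_abs]
    at hproj2
  have e2 : inner ℝ (v + (2 * L) • (y - x)) (p - y) =
      inner ℝ (y - p) u - inner ℝ (y - p) v - inner ℝ (y - p) sv := by
    have : v + (2 * L) • (y - x) = v - u + sv := by rw [hsv]; abel
    rw [this, ← neg_sub y p, inner_neg_right, real_inner_comm, inner_add_right, inner_sub_right]
    ring
  rw [e2, norm_sub_rev p y] at hsub
  have hs2 : ‖sv‖ ^ 2 ≤ (2 * G) ^ 2 := pow_le_pow_left₀ (norm_nonneg _) hs 2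
  have h1 := mul_le_mul_of_nonneg_left hproj2 (by positivity : 0 ≤ (t + 1) * t)
  have h2 := mul_le_mul_of_nonneg_left hsub (by positivity : 0 ≤ 4 * t / L)
  have h3 : (t + 1) * t * ((2 / (L * (t + 1))) ^ 2 * ‖sv‖ ^ 2) ≤ 16 * G ^ 2 / L ^ 2 := by
    calc (t + 1) * t * ((2 / (L * (t + 1))) ^ 2 * ‖sv‖ ^ 2)
        ≤ (t + 1) * t * ((2 / (L * (t + 1))) ^ 2 * (2 * G) ^ 2) := by gcongr
      _ = t / (t + 1) * (16 * G ^ 2 / L ^ 2) := by field_simp; ring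
      _ ≤ 1 * (16 * G ^ 2 / L ^ 2) := by
          gcongr; rw [div_le_one (by positivity)]; linarith
      _ = _ := one_mul _
  have e3 : (t + 1) * t * (2 * (2 / (L * (t + 1)) * inner ℝ (y - p) sv)) =
      4 * t / L * inner ℝ (y - p) sv := by field_simp; ring
  -- Strong convexity removes `2t` from `(t + 1) t`, leaving the coefficient `t (t - 1)` that
  -- telescopes.
  have e4 : 4 * t / L * (L / 2 * ‖y - p‖ ^ 2) = 2 * t * ‖y - p‖ ^ 2 := by field_simp; ring
  linarith

theorem measurableSet_proxObjective_gt {d : ℕ} {L : ℝ} (hL : 0 ≤ L)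
    {g : EuclideanSpace ℝ (Fin d) → ℝ} (hg : IsWeaklyConvex L g)
    (x : EuclideanSpace ℝ (Fin d)) (r : ℝ) : MeasurableSet {z | r < proxObjective L g x z} :=
  measurableSet_lt measurable_const (continuous_proxObjective hL hg x).measurable

/-- Tail bound for the output of the remaining `n` iterations of projected SGD. The number `S`
bounds the weighted sum of the objective values at the earlier iterates. -/
theorem law_projectedSGD_tail_le {d : ℕ} {L G : ℝ} (hL : 0 < L) (hG : 0 < G)
    {g : EuclideanSpace ℝ (Fin d) → ℝ} (hg : IsWeaklyConvex L g)
    {κ : Kernel (EuclideanSpace ℝ (Fin d)) (EuclideanSpace ℝ (Fin d))} [IsMarkovKernel κ]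
    (hκ : IsStochasticSubgradientOracle L G g κ) {x p : EuclideanSpace ℝ (Fin d)}
    (hp : ∀ z, proxObjective L g x p ≤ proxObjective L g x z)
    (hpx : p ∈ Metric.closedBall x (G / (2 * L))) {T : ℕ} (hT : 0 < T) (θ : ℝ) (n : ℕ) :
    ∀ (t : ℕ) (y acc : EuclideanSpace ℝ (Fin d)) (S : ℝ), t + n = T + 1 →
      y ∈ Metric.closedBall x (G / (2 * L)) →
      -- Jensen's inequality in a form that needs no record of past iterates: every supporting
      -- affine function, summed with the weights used so far (total `t (t - 1) / (T (T + 1))`),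
      -- stays below `S`. At the end the total is `1`, and `q = acc` gives `F acc ≤ S`.
      (∀ q v, (∀ z, proxObjective L g x q + inner ℝ v (z - q) ≤ proxObjective L g x z) →
        t * (t - 1) / (T * (T + 1)) * proxObjective L g x q +
          inner ℝ v (acc - ((t * (t - 1) / (T * (T + 1)) : ℝ)) • q) ≤ S) →
      (projectedSGD (ballProj x (G / (2 * L))) (fun y u => u + (2 * L) • (y - x))
        (fun t => 2 / (L * (t + 1))) (fun t => 2 * t / (T * (T + 1))) n t y acc).law κ
          {z | proxObjective L g x p + θ < proxObjective L g x z} ≤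
        ENNReal.ofReal (Real.exp (L * (T + 1) / (8 * G ^ 2) *
            (S - t * (t - 1) / (T * (T + 1)) * proxObjective L g x p - θ)
          + L ^ 2 / (8 * G ^ 2 * T) * (t * (t - 1) * ‖y - p‖ ^ 2) + 2 / T * n)) := by
  have hT' : (0 : ℝ) < T := by exact_mod_cast hT
  induction n with
  | zero =>
    intro t y acc S htn hy hS
    obtain rfl : t = T + 1 := htn
    have hW : ((T + 1 : ℕ) : ℝ) * ((T + 1 : ℕ) - 1) / (T * (T + 1)) = 1 := by
      push_cast; field_simp; ring
    simp only [hW, one_mul, one_smul] at hS ⊢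
    simp only [projectedSGD, OracleProgram.law]
    rw [Measure.dirac_apply' _ (measurableSet_proxObjective_gt hL.le hg x _)]
    -- Chernoff step: on the bad event the indicator is `1`, while `F acc ≤ S` makes the exponent
    -- nonnegative.
    by_cases hacc : proxObjective L g x p + θ < proxObjective L g x acc
    · rw [Set.indicator_of_mem (by exact hacc), Pi.one_apply, ENNReal.one_le_ofReal]
      refine Real.one_le_exp ?_
      obtain ⟨v, hv⟩ := hg acc
      have h := hS acc (v + (2 * L) • (acc - x)) fun z =>
        le_trans (le_add_of_nonneg_right (by positivity)) (hv.proxObjective_le x z)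
      rw [sub_self, inner_zero_right, add_zero] at h
      have h1 : 0 ≤ S - proxObjective L g x p - θ := by linarith
      push_cast
      rw [add_sub_cancel_right]
      positivity
    · rw [Set.indicator_of_notMem (by exact hacc)]
      exact zero_le
  | succ n ih =>
    intro t y acc S htn hy hS
    have hr : 0 ≤ G / (2 * L) := by positivity
    have hproj := measurable_ballProj x (G / (2 * L))
    have hs : Measurable (Function.uncurry
        (fun y u : EuclideanSpace ℝ (Fin d) => u + (2 * L) • (y - x))) := by
      unfold Function.uncurry; fun_prop
    have hA := measurableSet_proxObjective_gt hL.le hg x (proxObjective L g x p + θ)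
    simp only [projectedSGD, OracleProgram.law]
    rw [Measure.bind_apply hA (measurable_law_projectedSGD_answer hproj hs _ _ κ n (t + 1) y
      (acc + (2 * t / (T * (T + 1)) : ℝ) • y) (2 / (L * (t + 1)))).aemeasurable]
    obtain ⟨hbd, hmean⟩ := hκ y
    set v := ∫ u, u ∂(κ y) with hvdef
    set D := ‖y - p‖ ^ 2 with hD
    set Fy := proxObjective L g x y with hFy
    set Fp := proxObjective L g x p with hFp
    -- `b` makes the Hoeffding cost of a step `b t D (t / T) ≤ b t D`; `a` makes `a γ = 2 b t / L`,
    -- half of the gap coefficient `4 b t / L`. The other half pays the Hoeffding cost through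
    -- `hgrow`.
    set b : ℝ := L ^ 2 / (8 * G ^ 2 * T) with hb
    set a : ℝ := L * (T + 1) / (8 * G ^ 2) with ha
    set γ : ℝ := 2 * t / (T * (T + 1)) with hγ
    have hWs : ((t + 1 : ℕ) : ℝ) * ((t + 1 : ℕ) - 1) / (T * (T + 1)) =
        t * (t - 1) / (T * (T + 1)) + γ := by
      rw [hγ]; push_cast; field_simp; ring
    set W : ℝ := t * (t - 1) / (T * (T + 1)) with hW
    have hS' : ∀ q v, (∀ z, proxObjective L g x q + inner ℝ v (z - q) ≤ proxObjective L g x z) →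
        (W + γ) * proxObjective L g x q + inner ℝ v (acc + γ • y - (W + γ) • q) ≤ S + γ * Fy := by
      intro q v hqv
      have h1 := hS q v hqv
      have h2 := mul_le_mul_of_nonneg_left (hqv y) (by positivity : 0 ≤ γ)
      have e : acc + γ • y - (W + γ) • q = (acc - W • q) + γ • (y - q) := by module
      rw [e, inner_add_right, real_inner_smul_right]
      linarith
    set A : ℝ := a * (S + γ * Fy - (W + γ) * Fp - θ)
      + b * (t * (t - 1) * D - 4 * t / L * (Fy - Fp) + 16 * G ^ 2 / L ^ 2) + 2 / T * n with hAdef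
    have hbpos : 0 < b := by positivity
    have hstep : ∀ᵐ u ∂(κ y), (projectedSGD (ballProj x (G / (2 * L)))
        (fun y u => u + (2 * L) • (y - x)) (fun t => 2 / (L * (t + 1)))
        (fun t => 2 * t / (T * (T + 1))) n (t + 1)
        (ballProj x (G / (2 * L)) (y - (2 / (L * (t + 1)) : ℝ) • (u + (2 * L) • (y - x))))
        (acc + γ • y)).law κ {z | Fp + θ < proxObjective L g x z} ≤
        ENNReal.ofReal (Real.exp A) * ENNReal.ofReal (Real.exp
          (-(4 * b * t / L) * (inner ℝ (y - p) u - inner ℝ (y - p) v))) := by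
      filter_upwards [hbd] with u hu
      refine (ih (t + 1) _ _ (S + γ * Fy) (by omega) (ballProj_mem x hr _) ?_).trans ?_
      · simpa only [hWs] using hS'
      · rw [← ENNReal.ofReal_mul (Real.exp_pos _).le, ← Real.exp_add, hWs]
        refine ENNReal.ofReal_le_ofReal (Real.exp_le_exp.mpr ?_)
        have h := mul_le_mul_of_nonneg_left
          (sgd_step_le hL hG hpx hy hu hmean (Nat.cast_nonneg t)) hbpos.le
        have e : b * (4 * t / L * (inner ℝ (y - p) u - inner ℝ (y - p) v)) =
          4 * b * t / L * (inner ℝ (y - p) u - inner ℝ (y - p) v) := by ring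
        push_cast
        rw [add_sub_cancel_right]
        linarith
    refine (lintegral_mono_ae hstep).trans ?_
    rw [lintegral_const_mul' _ _ ENNReal.ofReal_ne_top]
    refine (mul_le_mul_right (lintegral_exp_inner_le hG.le hbd (y - p) _) _).trans ?_
    rw [← ENNReal.ofReal_mul (Real.exp_pos _).le, ← Real.exp_add]
    refine ENNReal.ofReal_le_ofReal (Real.exp_le_exp.mpr ?_)
    have hgrow : Fp + L / 2 * D ≤ Fy := hg.quadratic_growth hp y
    have htT : (t : ℝ) ≤ T := by exact_mod_cast (by omega : t ≤ T)
    have e1 : a * γ = 2 * b * t / L := by rw [ha, hγ, hb]; field_simp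
    -- The squared-step error is `2 / T` per iteration, hence `2` in total.
    have e2 : b * (16 * G ^ 2 / L ^ 2) = 2 / T := by rw [hb]; field_simp; ring
    have e3 : (G * ‖y - p‖) ^ 2 * (-(4 * b * t / L)) ^ 2 / 2 = b * t * D * (t / T) := by
      rw [hD, hb]; field_simp; ring
    have h1 : b * t * D * (t / T) ≤ b * t * D * 1 := by
      gcongr; rwa [div_le_one hT']
    have h2 : 2 * b * t / L * (L / 2 * D) ≤ 2 * b * t / L * (Fy - Fp) := by
      gcongr; linarith
    have e4 : 2 * b * t / L * (L / 2 * D) = b * t * D := by field_simp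
    have e5 : A = a * (S - W * Fp - θ) + a * γ * (Fy - Fp) + b * (t * (t - 1) * D)
        - 2 * (2 * b * t / L * (Fy - Fp)) + b * (16 * G ^ 2 / L ^ 2) + 2 / T * n := by
      rw [hAdef]; ring
    rw [e3, e5, e1, e2]
    push_cast
    linarith

/-- High-probability bound for projected SGD on the prox subproblem. -/
theorem law_proxSGD_tail_le {d : ℕ} {L G : ℝ} (hL : 0 < L) (hG : 0 < G)
    {g : EuclideanSpace ℝ (Fin d) → ℝ} (hg : IsWeaklyConvex L g)
    {κ : Kernel (EuclideanSpace ℝ (Fin d)) (EuclideanSpace ℝ (Fin d))} [IsMarkovKernel κ]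
    (hκ : IsStochasticSubgradientOracle L G g κ) {x x₁ p : EuclideanSpace ℝ (Fin d)}
    (hp : ∀ z, proxObjective L g x p ≤ proxObjective L g x z)
    (hx₁ : x₁ ∈ Metric.closedBall x (G / (2 * L))) {T : ℕ} (hT : 0 < T) (θ : ℝ) :
    (proxSGD L G T x x₁).law κ {z | proxObjective L g x p + θ < proxObjective L g x z} ≤
      ENNReal.ofReal (Real.exp (2 - L * (T + 1) / (8 * G ^ 2) * θ)) := by
  have hpx : p ∈ Metric.closedBall x (G / (2 * L)) := by
    rw [mem_closedBall_iff_norm]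
    refine norm_prox_sub_le hL hG.le (fun z => ⟨_, ?_, (hκ z).2⟩) hp
    simpa using norm_integral_le_of_norm_le_const (hκ z).1
  have hT' : (0 : ℝ) < T := by exact_mod_cast hT
  refine (law_projectedSGD_tail_le hL hG hg hκ hp hpx hT θ T 1 x₁ 0 0 (add_comm _ _) hx₁
    (by simp)).trans (ENNReal.ofReal_le_ofReal (Real.exp_le_exp.mpr (le_of_eq ?_)))
  simp only [Nat.cast_one, sub_self, mul_zero, zero_mul, zero_div, zero_sub, add_zero]
  field_simp
  ring

/-! ### Choice of constants and conclusion. -/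

theorem isProbabilityMeasure_law_proxSGD {d : ℕ} (L G : ℝ) (T : ℕ)
    (x x₁ : EuclideanSpace ℝ (Fin d))
    (κ : Kernel (EuclideanSpace ℝ (Fin d)) (EuclideanSpace ℝ (Fin d))) [IsMarkovKernel κ] :
    IsProbabilityMeasure ((proxSGD L G T x x₁).law κ) :=
  isProbabilityMeasure_law_projectedSGD (measurable_ballProj _ _)
    (by unfold Function.uncurry; fun_prop) _ _ κ T 1 x₁ 0

theorem law_moreauGradientEstimate {d : ℕ} (c L G ε δ : ℝ) (x x₁ : EuclideanSpace ℝ (Fin d))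
    (κ : Kernel (EuclideanSpace ℝ (Fin d)) (EuclideanSpace ℝ (Fin d))) [IsMarkovKernel κ] :
    (moreauGradientEstimate c L G ε δ x x₁).law κ =
      ((proxSGD L G (sgdIterations c G ε δ) x x₁).law κ).map (fun z => (2 * L) • (x - z)) :=
  law_map_projectedSGD (measurable_ballProj _ _) (by unfold Function.uncurry; fun_prop) _ _ κ
    (by fun_prop) _ 1 x₁ 0

/-- The constant is `192 = 3 * 64`: the exponent loses at least `3 log (2/δ)`, and `3 log 2 > 2`
cancels the additive `2`. -/
theorem two_sub_mul_le_log {L G ε δ : ℝ} (hL : 0 < L) (hG : 0 < G) (hε : 0 < ε) (hδ : 0 < δ)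
    (hδ1 : δ < 1) {T : ℕ} (hT : 192 * G ^ 2 * Real.log (2 / δ) / ε ^ 2 ≤ T) :
    2 - L * (T + 1) / (8 * G ^ 2) * (ε ^ 2 / (8 * L)) ≤ Real.log δ := by
  have hlog := Real.log_two_gt_d9
  have hδlog : Real.log δ < 0 := Real.log_neg hδ hδ1
  rw [Real.log_div two_ne_zero hδ.ne', div_le_iff₀ (by positivity)] at hT
  have e : L * (T + 1) / (8 * G ^ 2) * (ε ^ 2 / (8 * L)) = (T + 1) * ε ^ 2 / (64 * G ^ 2) := by
    field_simp; norm_num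
  have h : 3 * (Real.log 2 - Real.log δ) ≤ (T + 1) * ε ^ 2 / (64 * G ^ 2) := by
    rw [le_div_iff₀ (by positivity)]
    nlinarith [sq_nonneg ε]
  rw [e]
  linarith

/-- As `log (1/δ) ≥ log 2 > 1/2`, both `log (2/δ)` and the `1` lost by rounding up are at most `2
log (1/δ)`; `ε ≤ G` lets the factor `G² / ε²` cover the latter. -/
theorem query_bound {G ε δ c : ℝ} (hc : 0 < c) (hε : 0 < ε) (hδ : 0 < δ)
    (hδ2 : δ ≤ 1 / 2) (hεG : ε ≤ G) :
    (⌈c * G ^ 2 * Real.log (2 / δ) / ε ^ 2⌉₊ : ℝ) ≤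
      (2 * c + 2) * G ^ 2 * Real.log (1 / δ) / ε ^ 2 := by
  have hlog := Real.log_two_gt_d9
  have hlogδ : Real.log 2 ≤ Real.log (1 / δ) := by
    refine Real.log_le_log two_pos ?_
    rw [le_div_iff₀ hδ]; linarith
  have e : Real.log (2 / δ) = Real.log 2 + Real.log (1 / δ) := by
    rw [← Real.log_mul two_ne_zero (by positivity), mul_one_div]
  have hpos : 0 ≤ Real.log (2 / δ) := by rw [e]; linarith
  refine (Nat.ceil_lt_add_one (by positivity)).le.trans ?_
  have h1 : (c * G ^ 2 * Real.log (2 / δ) + ε ^ 2) / ε ^ 2 ≤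
      (2 * c + 2) * G ^ 2 * Real.log (1 / δ) / ε ^ 2 := by
    gcongr
    have h2 : ε ^ 2 ≤ G ^ 2 := by gcongr
    have h3 : c * G ^ 2 * Real.log (2 / δ) ≤ c * G ^ 2 * (2 * Real.log (1 / δ)) := by
      gcongr; linarith
    have h4 : G ^ 2 * 1 ≤ G ^ 2 * (2 * Real.log (1 / δ)) := by
      gcongr; linarith
    linarith
  rwa [add_div, div_self (by positivity)] at h1

theorem mainTheorem7 :
    ∃ c C : ℝ, 0 < c ∧ 0 < C ∧
      ∀ (d : ℕ) (L G ε δ : ℝ), 0 < L → 0 < G → 0 < ε → 0 < δ → δ < 1 →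
      ∀ (g : EuclideanSpace ℝ (Fin d) → ℝ), IsWeaklyConvex L g →
      ∀ (κ : Kernel (EuclideanSpace ℝ (Fin d)) (EuclideanSpace ℝ (Fin d))) [IsMarkovKernel κ],
        IsStochasticSubgradientOracle L G g κ →
      ∀ (x x₁ : EuclideanSpace ℝ (Fin d)), x₁ ∈ Metric.closedBall x (G / (2 * L)) →
        DifferentiableAt ℝ (moreauEnvelope g (1 / (2 * L))) x ∧
        ENNReal.ofReal (1 - δ) ≤
          (proxSGD L G (sgdIterations c G ε δ) x x₁).law κ
            {xt | g xt + L * ‖x - xt‖ ^ 2 ≤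
              (⨅ x', g x' + L * ‖x - x'‖ ^ 2) + ε ^ 2 / (4 * L)} ∧
        ENNReal.ofReal (1 - δ) ≤
          (moreauGradientEstimate c L G ε δ x x₁).law κ
            {u | ‖u - gradient (moreauEnvelope g (1 / (2 * L))) x‖ ≤ ε} ∧
        (moreauGradientEstimate c L G ε δ x x₁).QueriesAtMost
          ⌈c * G ^ 2 * Real.log (2 / δ) / ε ^ 2⌉₊ ∧
        (δ ≤ 1 / 2 → ε ≤ G → ∃ N : ℕ, (N : ℝ) ≤ C * G ^ 2 * Real.log (1 / δ) / ε ^ 2 ∧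
          (moreauGradientEstimate c L G ε δ x x₁).QueriesAtMost N) := by
  refine ⟨192, 2 * 192 + 2, by norm_num, by norm_num, ?_⟩
  intro d L G ε δ hL hG hε hδ hδ1 g hg κ _ hκ x x₁ hx₁
  obtain ⟨p, hp⟩ := hg.exists_prox hL x
  have hgrad := hg.hasGradientAt_moreauEnvelope hL hp
  set T := sgdIterations 192 G ε δ with hTdef
  have hTle : 192 * G ^ 2 * Real.log (2 / δ) / ε ^ 2 ≤ T := Nat.le_ceil _
  have hT : 0 < T := by
    have : 0 < Real.log (2 / δ) := Real.log_pos (by rw [lt_div_iff₀ hδ]; linarith)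
    exact Nat.ceil_pos.mpr (by positivity)
  have := isProbabilityMeasure_law_proxSGD L G T x x₁ κ
  -- The gap `ε² / (8L)`, half of what the first claim needs, is exactly what quadratic growth turns
  -- into `2L ‖z - p‖ ≤ ε`. One event thus serves both claims.
  have hgood : ENNReal.ofReal (1 - δ) ≤ (proxSGD L G T x x₁).law κ
      {z | proxObjective L g x p + ε ^ 2 / (8 * L) < proxObjective L g x z}ᶜ := by
    rw [prob_compl_eq_one_sub (measurableSet_proxObjective_gt hL.le hg x _),
      ENNReal.ofReal_sub 1 hδ.le, ENNReal.ofReal_one]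
    refine tsub_le_tsub_left ((law_proxSGD_tail_le hL hG hg hκ hp hx₁ hT _).trans ?_) 1
    refine ENNReal.ofReal_le_ofReal ?_
    rw [← Real.le_log_iff_exp_le hδ]
    exact two_sub_mul_le_log hL hG hε hδ hδ1 hTle
  have hquery : ∀ N, T = N → (moreauGradientEstimate 192 L G ε δ x x₁).QueriesAtMost N := by
    rintro N rfl
    exact queriesAtMost_map_projectedSGD _ _ _ T 1 x₁ 0
  refine ⟨hgrad.differentiableAt, ?_, ?_, hquery _ rfl, fun hδ2 hεG => ⟨_, ?_, hquery _ rfl⟩⟩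
  · refine hgood.trans (measure_mono fun z hz => ?_)
    rw [Set.mem_compl_iff, Set.mem_ofPred_eq, not_lt] at hz
    rw [Set.mem_ofPred_eq, iInf_proxObjective hp]
    refine hz.trans ?_
    gcongr
    norm_num
  · rw [law_moreauGradientEstimate, hgrad.gradient, Measure.map_apply (by fun_prop)
      (measurableSet_le (by fun_prop) (by fun_prop))]
    refine hgood.trans (measure_mono fun z hz => ?_)
    rw [Set.mem_compl_iff, Set.mem_ofPred_eq, not_lt] at hz
    have h1 := (hg.quadratic_growth hp z).trans hz
    have e : (2 * L) • (x - z) - (2 * L) • (x - p) = (-(2 * L)) • (z - p) := by module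
    rw [Set.mem_preimage, Set.mem_ofPred_eq, e, norm_smul, norm_neg, Real.norm_eq_abs,
      abs_of_pos (by positivity)]
    refine (pow_le_pow_iff_left₀ (by positivity) hε.le two_ne_zero).mp ?_
    have h2 : L / 2 * ‖z - p‖ ^ 2 ≤ ε ^ 2 / (8 * L) := by linarith
    rw [le_div_iff₀ (by positivity)] at h2
    linarith
  · exact query_bound (by norm_num) hε hδ hδ2 hεG
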